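/- Fix $0<a<1$. In the Asymmetric($a$) system there are two task types $c_1,c_2$ and two experts $s_1,s_2$. Tasks arrive at the instants of a Poisson process of rate $\lambda>0$; the type of each arriving task is unknown to the scheduler and equally likely to be $c_1$ or $c_2$. Attempt durations are independent exponential variables of rate $1$. An attempt on a task succeeds, independently of everything else, with probability $p_{s,c}$, where $p_{s_1,c_1}=p_{s_2,c_1}=1$, $p_{s_1,c_2}=a$, $p_{s_2,c_2}=0$; on success the task leaves, on failure it stays in the system. The mixed type of a task is the posterior distribution of its type given its past attempts; it equals $z'=(1/2,1/2)$ before the first failure and $z''=(0,1)$ afterwards. Several experts may work on the same task. A policy assigns to the experts outstanding tasks (or lets them idle) on the basis of the vector $N(t)=(N_{z'}(t),N_{z''}(t))$ of numbers of outstanding tasks of each mixed type, the past, and possibly randomization; it stabilizes the system if it induces a time-stationary regime. Under the Preemptive Greedy policy, at each time each expert $s$ works on an outstanding task whose mixed type $z$ maximizes the success probability $\sum_c z_c\,p_{s,c}$ among the outstanding tasks, ties being broken uniformly at random. The Preemptive Greedy policy stabilizes the Asymmetric($a$) system if and only if $\lambda<\frac{4a}{2+a}$. This threshold is strictly below the optimal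 throughput, i.e. the supremum of the arrival rates $\lambda$ for which some policy stabilizes the system. For $a=1/2$ the threshold is $4/5$, and the optimal throughput is $25\%$ higher than it. -/

import Mathlib

open scoped NNReal ENNReal

noncomputable section

namespace TaskExpert

/-- Probability that an attempt by expert `s` on a task whose type has distribution `z` fails,
when expert `s` resolves a task of type `c` with probability `p s c`. -/
def failureProb {C S : Type} [Fintype C] (p : S → C → ℝ) (s : S) (z : C → ℝ) : ℝ :=
  ∑ c, z c * (1 - p s c)

/-- Posterior distribution of the type after a failed attempt by expert `s`
(meaningful when the failure probability is nonzero). -/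
def posterior {C S : Type} [Fintype C] (p : S → C → ℝ) (s : S) (z : C → ℝ) : C → ℝ :=
  fun c => z c * (1 - p s c) / failureProb p s z

/-- A task-expert system with finite sets `C` of task types and `S` of experts. -/
structure System (C S : Type) [Fintype C] [Fintype S] where
  /-- success probability of an expert on a task of given (pure) type -/
  p : S → C → ℝ
  p_mem : ∀ s c, p s c ∈ Set.Icc (0 : ℝ) 1
  /-- service rate of each expert: attempts last an exponential time of this parameter -/
  rate : S → ℝ
  rate_pos : ∀ s, 0 < rate s
  /-- intensity of the Poisson process of arrivals -/
  arrivalRate : ℝ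
  arrivalRate_pos : 0 < arrivalRate
  /-- the countable set of mixed types (distributions on the set of types) -/
  Z : Set (C → ℝ)
  Z_countable : Z.Countable
  Z_subset : Z ⊆ stdSimplex ℝ C
  Z_closed : ∀ z ∈ Z, ∀ s, failureProb p s z ≠ 0 → posterior p s z ∈ Z
  /-- law of the mixed type of an arriving task -/
  prior : PMF Z

/-- What happens at an event of the system: a task of mixed type `z` arrives, or the service clock
of an expert rings while he attempts a task of mixed type `z` (with success or failure) or while
he idles. -/
inductive Outcome (S Z : Type) where
  | arrival (z : Z)
  | success (s : S) (z : Z)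
  | failure (s : S) (z : Z)
  | idle (s : S)

namespace System

variable {C S : Type} [Fintype C] [Fintype S] (sys : System C S)

/-- The vector `N = (N_z)` of numbers of outstanding tasks of each mixed type. -/
abbrev State : Type := sys.Z →₀ ℕ

/-- Failure probability on a mixed type of the system. -/
def psi (s : S) (z : sys.Z) : ℝ := failureProb sys.p s z

open Classical in
/-- The mixed type of a task of mixed type `z` after a failed attempt by `s`. (The second branch
is only ever used with probability zero.) -/
def phi (s : S) (z : sys.Z) : sys.Z :=
  if h : failureProb sys.p s z ≠ 0 then ⟨posterior sys.p s z, sys.Z_closed z z.2 s h⟩ else z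

theorem psi_nonneg (s : S) (z : sys.Z) : 0 ≤ sys.psi s z :=
  Finset.sum_nonneg fun c _ =>
    mul_nonneg ((sys.Z_subset z.2).1 c) (sub_nonneg.2 (sys.p_mem s c).2)

theorem psi_le_one (s : S) (z : sys.Z) : sys.psi s z ≤ 1 := by
  rw [← (sys.Z_subset z.2).2]
  exact Finset.sum_le_sum fun c _ =>
    mul_le_of_le_one_right ((sys.Z_subset z.2).1 c) (by linarith [(sys.p_mem s c).1])

/-- Law of the result of an attempt: `true` (failure) with probability `ψ_s(z)`, `false` (success)
with probability `1 - ψ_s(z)`. -/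
def failureLaw (s : S) (z : sys.Z) : PMF Bool :=
  PMF.ofFintype
    (fun b => if b then ENNReal.ofReal (sys.psi s z) else ENNReal.ofReal (1 - sys.psi s z))
    (by
      simp only [Fintype.sum_bool, if_true, Bool.false_eq_true, if_false]
      rw [← ENNReal.ofReal_add (sys.psi_nonneg s z) (sub_nonneg.2 (sys.psi_le_one s z))]
      simp)

/-- Rates of the Poisson clocks that drive the system: the arrivals (`none`), and the service
clock of each expert (`some s`). -/
def clockRate : Option S → ℝ
  | none => sys.arrivalRate
  | some s => sys.rate s

theorem clockRate_pos (e : Option S) : 0 < sys.clockRate e := by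
  cases e with
  | none => exact sys.arrivalRate_pos
  | some s => exact sys.rate_pos s

/-- Total event rate `λ + ∑ s, μ_s`. -/
def totalRate : ℝ := ∑ e, sys.clockRate e

theorem totalRate_pos : 0 < sys.totalRate :=
  Finset.sum_pos (fun e _ => sys.clockRate_pos e) ⟨none, Finset.mem_univ _⟩

/-- Which of the independent clocks rings at an event of their superposition: each with
probability proportional to its rate. -/
def clockLaw : PMF (Option S) :=
  PMF.ofFintype (fun e => ENNReal.ofReal (sys.clockRate e / sys.totalRate)) (by
    rw [← ENNReal.ofReal_sum_of_nonneg
      fun e _ => div_nonneg (sys.clockRate_pos e).le sys.totalRate_pos.le, ← Finset.sum_div]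
    change ENNReal.ofReal (sys.totalRate / sys.totalRate) = 1
    rw [div_self sys.totalRate_pos.ne', ENNReal.ofReal_one])

/-- A scheduling policy. It may base its decisions on the vector `N` and on a memory (taking
countably many values) in which it records what it wants of the past; it may randomize, may let
experts idle, may preempt or not, and may assign several experts to the same task. -/
structure Policy where
  /-- the set of values of the memory -/
  Mem : Type
  mem_countable : Countable Mem
  /-- law of the mixed type of the task on which expert `s` works (`none`: he idles) -/
  assign : sys.State → Mem → S → PMF (Option sys.Z)
  /-- only outstanding tasks can be served -/
  outstanding : ∀ n m s z, assign n m s (some z) ≠ 0 → 0 < n z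
  /-- law of the new memory, given the vector `N` and the memory just before the event, and the
  event -/
  update : sys.State → Mem → Outcome S sys.Z → PMF Mem

namespace Policy

variable {sys} (P : sys.Policy)

/-- Law of the state (and memory) just after the next event, given the present state. -/
def step (x : sys.State × P.Mem) : PMF (sys.State × P.Mem) :=
  sys.clockLaw.bind fun e =>
    match e with
    | none => sys.prior.bind fun z =>
        (P.update x.1 x.2 (.arrival z)).map fun m => (x.1 + Finsupp.single z 1, m)
    | some s => (P.assign x.1 x.2 s).bind fun w =>
        match w with
        | none => (P.update x.1 x.2 (.idle s)).map fun m => (x.1, m)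
        | some z => (sys.failureLaw s z).bind fun failed =>
            if failed then
              (P.update x.1 x.2 (.failure s z)).map fun m =>
                (x.1 - Finsupp.single z 1 + Finsupp.single (sys.phi s z) 1, m)
            else
              (P.update x.1 x.2 (.success s z)).map fun m => (x.1 - Finsupp.single z 1, m)

/-- Law of the state just after the `k`-th event, started from `x`. -/
def stepIter : ℕ → sys.State × P.Mem → PMF (sys.State × P.Mem)
  | 0, x => PMF.pure x
  | k + 1, x => (P.step x).bind (stepIter k)

/-- Transition function of the continuous-time Markov chain: law of the state at time `t`, started
from `x` at time `0`. The number of events up to time `t` is Poisson distributed with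
mean `totalRate * t`, and is independent of what happens at the successive events. -/
def transition (t : ℝ≥0) (x : sys.State × P.Mem) : PMF (sys.State × P.Mem) :=
  (ProbabilityTheory.poissonMeasure (sys.totalRate.toNNReal * t)).toPMF.bind
    fun k => P.stepIter k x

/-- The policy stabilizes the system if it induces a time-stationary regime: there is a
probability distribution of the initial state under which the state has the same law at all
times. -/
def Stabilizes : Prop :=
  ∃ q : PMF (sys.State × P.Mem), ∀ t : ℝ≥0, q.bind (P.transition t) = q

end Policy

/-- Some policy stabilizes the system. -/
def IsStabilizable : Prop := ∃ P : sys.Policy, P.Stabilizes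

open Classical in
/-- Outstanding mixed types with the least failure probability for expert `s`. -/
def greedySet (n : sys.State) (s : S) : Finset sys.Z :=
  n.support.filter fun z => ∀ w ∈ n.support, sys.psi s z ≤ sys.psi s w

theorem greedySet_nonempty {n : sys.State} (h : n ≠ 0) (s : S) : (sys.greedySet n s).Nonempty := by
  obtain ⟨z, hz, hmin⟩ :=
    n.support.exists_min_image (sys.psi s) (Finsupp.support_nonempty_iff.2 h)
  exact ⟨z, Finset.mem_filter.2 ⟨hz, hmin⟩⟩

open Classical in
/-- Law of the mixed type assigned to expert `s`: uniform on the greedy set. -/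
def greedyAssign (n : sys.State) (s : S) : PMF (Option sys.Z) :=
  if h : n = 0 then PMF.pure none
  else (PMF.uniformOfFinset (sys.greedySet n s) (sys.greedySet_nonempty h s)).map some

/-- The Preemptive Greedy policy: at each time each expert works on an outstanding task with the
highest success probability for him, ties being broken uniformly at random. It has no memory. -/
def preemptiveGreedy : sys.Policy where
  Mem := Unit
  mem_countable := inferInstance
  assign n _ s := sys.greedyAssign n s
  outstanding n _ s z h := by
    by_cases hn : n = 0
    · simp [greedyAssign, hn] at h
    · have h' : some z ∈ (sys.greedyAssign n s).support := h
      simp only [greedyAssign, hn, dif_neg, not_false_eq_true, PMF.mem_support_map_iff,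
        PMF.mem_support_uniformOfFinset_iff, Option.some.injEq, exists_eq_right] at h'
      exact Nat.pos_of_ne_zero (Finsupp.mem_support_iff.1 (Finset.mem_filter.1 h').1)
  update _ _ _ := PMF.pure ()

end System

/-- Success probabilities of the Asymmetric(a) system: experts `0, 1` are `s₁, s₂`, types `0, 1`
are `c₁, c₂`. -/
def asymmetricP (a : ℝ) : Fin 2 → Fin 2 → ℝ := ![![1, a], ![1, 0]]

/-- The mixed type `z'` of every arriving task. -/
def mixedNew : Fin 2 → ℝ := ![1 / 2, 1 / 2]

/-- The mixed type `z''` of a task that has received a failure. -/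
def mixedFailed : Fin 2 → ℝ := ![0, 1]

/-- The Asymmetric(a) system with arrival rate `lam`. -/
def asymmetric (a lam : ℝ) (ha₀ : 0 < a) (ha₁ : a < 1) (hlam : 0 < lam) :
    System (Fin 2) (Fin 2) where
  p := asymmetricP a
  p_mem s c := by
    fin_cases s <;> fin_cases c <;> simp [asymmetricP, ha₀.le, ha₁.le]
  rate _ := 1
  rate_pos _ := one_pos
  arrivalRate := lam
  arrivalRate_pos := hlam
  Z := {mixedNew, mixedFailed}
  Z_countable := (Set.toFinite _).countable
  Z_subset := by
    rintro z (rfl | rfl)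
    · refine ⟨fun c => ?_, ?_⟩
      · fin_cases c <;> norm_num [mixedNew]
      · norm_num [mixedNew, Fin.sum_univ_two]
    · refine ⟨fun c => ?_, ?_⟩
      · fin_cases c <;> norm_num [mixedFailed]
      · norm_num [mixedFailed, Fin.sum_univ_two]
  Z_closed := by
    have h1 : 1 - a ≠ 0 := by linarith
    rintro z (rfl | rfl) s - <;> right <;> funext c <;> fin_cases s <;> fin_cases c <;>
      simp [posterior, failureProb, asymmetricP, mixedNew, mixedFailed, Fin.sum_univ_two, h1]
  prior := PMF.pure ⟨mixedNew, Or.inl rfl⟩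

end TaskExpert

end

/-! Time is removed first: by `stabilizes_iff`, a stationary regime is an invariant law of the chain
observed at its events. Everything then rests on drifts of functions of the two counts i (tasks of
type z') and j (type z''). Two criteria convert drift into a conclusion, and neither needs
irreducibility. Foster's criterion `exists_invariant_of_drift` produces an invariant law when the
drift is uniformly negative off a finite set. Conversely, by `drift_eq_zero_of_invariant`, a
nonnegative drift of a function with bounded increments must vanish on the support of any invariant
law.

Greedy experts both serve z' whenever i > 0: then i drains at rate 2 while failures feed j at rate
(2 - a)/2. They turn to z'' only when i = 0, and only the first expert is useful there, at rate a. A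
function c * i + j has negative drift in both regimes exactly when (2 - a)/(2(2 - λ)) < c < a/λ, and
for λ < 2 such a c exists iff λ < 4a/(2 + a). At or above this value the weight c = a/λ gives a
nonnegative drift that is positive at the empty state, which every invariant law charges: a
contradiction, critical case included.

The optimal throughput is the value min(2a, 3a/(1 + a)) of a linear program: maximize the service
rate of z' subject to z'' being drained at least as fast as it is fed. Dual solutions serve as
linear functions in `mul_le_of_stabilizes` and bound every policy. Primal solutions give randomized
static policies, stable below the bound by a quadratic Lyapunov function
(`staticPolicy_stabilizes`). -/

namespace TaskExpert

open Filter Topology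

/-! ### Expectations under discrete laws, with values in [0, ∞]. -/

section Expectation

variable {α β : Type*}

/-- Expectation of a nonnegative function under a discrete probability distribution. -/
noncomputable def expect (p : PMF α) (g : α → ℝ≥0∞) : ℝ≥0∞ := ∑' x, p x * g x

theorem expect_pure (x : α) (g : α → ℝ≥0∞) : expect (PMF.pure x) g = g x := by
  rw [expect, tsum_eq_single x (fun y hy => by simp [PMF.pure_apply, hy])]
  simp [PMF.pure_apply]

theorem expect_bind (p : PMF α) (f : α → PMF β) (g : β → ℝ≥0∞) :
    expect (p.bind f) g = expect p fun x => expect (f x) g := by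
  simp only [expect, PMF.bind_apply, ← ENNReal.tsum_mul_right, ← ENNReal.tsum_mul_left]
  rw [ENNReal.tsum_comm]
  simp only [mul_assoc]

theorem expect_map (p : PMF α) (f : α → β) (g : β → ℝ≥0∞) :
    expect (p.map f) g = expect p fun x => g (f x) := by
  rw [PMF.map, expect_bind]
  simp only [Function.comp, expect_pure]

theorem expect_const (p : PMF α) (c : ℝ≥0∞) : expect p (fun _ => c) = c := by
  rw [expect, ENNReal.tsum_mul_right, p.tsum_coe, one_mul]

theorem expect_add (p : PMF α) (g h : α → ℝ≥0∞) :
    expect p (fun x => g x + h x) = expect p g + expect p h := by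
  simp only [expect, mul_add, ENNReal.tsum_add]

theorem expect_const_mul (p : PMF α) (c : ℝ≥0∞) (g : α → ℝ≥0∞) :
    expect p (fun x => c * g x) = c * expect p g := by
  simp only [expect, ← ENNReal.tsum_mul_left, mul_left_comm]

theorem expect_mono {p : PMF α} {g h : α → ℝ≥0∞} (hgh : ∀ x, p x ≠ 0 → g x ≤ h x) :
    expect p g ≤ expect p h := by
  refine ENNReal.tsum_le_tsum fun x => ?_
  by_cases hx : p x = 0
  · simp [hx]
  · exact mul_le_mul_right (hgh x hx) _

theorem expect_fintype [Fintype α] (p : PMF α) (g : α → ℝ≥0∞) :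
    expect p g = ∑ x, p x * g x := tsum_fintype _

theorem expect_indicator_singleton (p : PMF α) (x : α) (c : ℝ≥0∞) :
    expect p (fun y => Set.indicator {x} (fun _ => c) y) = p x * c := by
  rw [expect, tsum_eq_single x (fun y hy => by simp [hy])]
  simp

/-- Both masses are 1, so no inequality can be strict. Thanks to this, invariance only ever has to
be proved as subinvariance. -/
theorem eq_of_pmf_le {p q : PMF α} (h : ∀ x, p x ≤ q x) : p = q := by
  refine PMF.ext fun x => ?_
  by_contra hx
  exact (ENNReal.tsum_lt_tsum p.tsum_coe_ne_top h (lt_of_le_of_ne (h x) hx)).ne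
    (p.tsum_coe.trans q.tsum_coe.symm)

end Expectation

/-! ### Drift criteria for invariant laws of a discrete chain. -/

section Invariance

variable {X : Type*} {K : X → PMF X} {q : PMF X}

theorem expect_expect_of_invariant (hq : q.bind K = q) (g : X → ℝ≥0∞) :
    expect q (fun x => expect (K x) g) = expect q g := by
  rw [← expect_bind, hq]

theorem ne_zero_of_invariant (hq : q.bind K = q) {x y : X} (hx : q x ≠ 0) (hxy : K x y ≠ 0) :
    q y ≠ 0 := by
  rw [← hq, ← PMF.mem_support_iff, PMF.mem_support_bind_iff]
  exact ⟨x, hx, hxy⟩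

/-- If a function with bounded increments has nonnegative drift everywhere, then under an invariant
distribution its drift vanishes almost surely. -/
theorem drift_eq_zero_of_invariant (hq : q.bind K = q) (V d : X → ℝ) (B : ℝ) (hB : 0 ≤ B)
    (hV : ∀ x, 0 ≤ V x) (hinc : ∀ x y, K x y ≠ 0 → |V y - V x| ≤ B) (hd : ∀ x, 0 ≤ d x)
    (hdrift : ∀ x, ENNReal.ofReal (V x + d x) ≤ expect (K x) fun y => ENNReal.ofReal (V y))
    {x₀ : X} (hx₀ : q x₀ ≠ 0) : d x₀ = 0 := by
  -- `V` need not be integrable under `q`, so it is truncated at `M + B`. From a state of `insert x₀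
  -- S` one jump cannot reach the truncation level, so the drift bound survives; elsewhere the
  -- truncated function loses at most `B` on average. Integrating against `q` leaves an error `B`
  -- times the mass outside `S`, which vanishes as `S` grows.
  have key : ∀ S : Finset X, q x₀ * ENNReal.ofReal (d x₀) ≤
      ENNReal.ofReal B * ∑' x : {x // x ∉ S}, q x := by
    classical
    intro S
    obtain ⟨M, hM⟩ : ∃ M : ℝ, ∀ x ∈ insert x₀ S, V x ≤ M :=
      let ⟨z, _, hz⟩ := (insert x₀ S).exists_max_image V (Finset.insert_nonempty _ _)
      ⟨V z, hz⟩
    let W : X → ℝ≥0∞ := fun y => ENNReal.ofReal (min (V y) (M + B))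
    have hpt : ∀ x, W x + Set.indicator {x₀} (fun _ => ENNReal.ofReal (d x₀)) x ≤
        expect (K x) W + ENNReal.ofReal B * Set.indicator {x | x ∉ S} (fun _ => 1) x := by
      intro x
      by_cases hx : x ∈ insert x₀ S
      · have hVx := hM x hx
        calc W x + Set.indicator {x₀} (fun _ => ENNReal.ofReal (d x₀)) x
            ≤ ENNReal.ofReal (V x) + ENNReal.ofReal (d x) := by
              refine add_le_add (ENNReal.ofReal_le_ofReal (min_le_left _ _)) ?_
              by_cases h : x = x₀ <;> simp [h]
          _ = ENNReal.ofReal (V x + d x) := (ENNReal.ofReal_add (hV x) (hd x)).symm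
          _ ≤ expect (K x) fun y => ENNReal.ofReal (V y) := hdrift x
          _ ≤ expect (K x) W := expect_mono fun y hy => ENNReal.ofReal_le_ofReal
              (le_min le_rfl (by linarith [(abs_le.1 (hinc x y hy)).2]))
          _ ≤ _ := le_self_add
      · rw [Finset.mem_insert, not_or] at hx
        simp only [Set.mem_singleton_iff, hx.1, not_false_eq_true, Set.indicator_of_notMem,
          add_zero, Set.mem_ofPred_eq, hx.2, Set.indicator_of_mem, mul_one]
        rw [← expect_const (K x) (W x), ← expect_const (K x) (ENNReal.ofReal B), ← expect_add]
        refine expect_mono fun y hy => ?_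
        refine (ENNReal.ofReal_le_ofReal ?_).trans ENNReal.ofReal_add_le
        rw [← min_add_add_right]
        exact min_le_min (by linarith [(abs_le.1 (hinc x y hy)).1]) (by linarith)
    have hint : expect q W + q x₀ * ENNReal.ofReal (d x₀) ≤
        expect q W + ENNReal.ofReal B * ∑' x : {x // x ∉ S}, q x := by
      have h := expect_mono (p := q) fun x _ => hpt x
      rw [expect_add, expect_add, expect_expect_of_invariant hq, expect_const_mul,
        expect_indicator_singleton] at h
      refine h.trans_eq ?_
      congr 2
      rw [expect]
      refine Eq.trans ?_ (tsum_subtype {x | x ∉ S} q).symm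
      refine tsum_congr fun x => ?_
      by_cases hx : x ∈ S <;> simp [hx]
    -- Cancelling `expect q W` is legitimate because `W` is bounded by `M + B`.
    refine (ENNReal.add_le_add_iff_left (ne_top_of_le_ne_top (ENNReal.ofReal_ne_top (r := M + B))
      ?_)).1 hint
    rw [← expect_const q (ENNReal.ofReal (M + B))]
    exact expect_mono fun x _ => ENNReal.ofReal_le_ofReal (min_le_right _ _)
  have hlim : Tendsto (fun S : Finset X => ENNReal.ofReal B * ∑' x : {x // x ∉ S}, q x) atTop
      (𝓝 (ENNReal.ofReal B * 0)) :=
    ENNReal.Tendsto.const_mul (ENNReal.tendsto_tsum_compl_atTop_zero q.tsum_coe_ne_top)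
      (Or.inr ENNReal.ofReal_ne_top)
  rw [mul_zero] at hlim
  have h0 : q x₀ * ENNReal.ofReal (d x₀) ≤ 0 := ge_of_tendsto' hlim key
  have h1 := (mul_eq_zero.1 (le_antisymm h0 zero_le)).resolve_left hx₀
  exact le_antisymm (ENNReal.ofReal_eq_zero.1 h1) (hd x₀)

/-- **Foster's criterion**, for the existence of an invariant distribution. -/
theorem exists_invariant_of_drift (K : X → PMF X) (V : X → ℝ≥0∞) (F : Finset X) (ε b : ℝ≥0∞)
    (hε : ε ≠ 0) (hb : b ≠ ∞) {x₀ : X} (hx₀ : V x₀ ≠ ∞)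
    (hdrift : ∀ x, expect (K x) V + ε ≤ V x + Set.indicator (F : Set X) (fun _ => b) x) :
    ∃ q : PMF X, q.bind K = q := by
  -- laws of the chain, and their Cesàro averages
  let law : ℕ → PMF X := fun n => (fun p => PMF.bind p K)^[n] (PMF.pure x₀)
  have law_succ : ∀ n, law (n + 1) = (law n).bind K := fun n =>
    Function.iterate_succ_apply' _ _ _
  let avg : ℕ → X → ℝ≥0∞ := fun n x => (n : ℝ≥0∞)⁻¹ * ∑ k ∈ Finset.range n, law k x
  have hlawF : ∀ n, expect (law n) (fun x => Set.indicator (F : Set X) (fun _ => b) x) =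
      b * ∑ x ∈ F, law n x := by
    intro n
    rw [expect, tsum_eq_sum (s := F) (fun x hx => by simp [hx]), Finset.mul_sum]
    exact Finset.sum_congr rfl fun x hx => by simp [hx, mul_comm]
  have hstep : ∀ n, expect (law (n + 1)) V + ε ≤ expect (law n) V + b * ∑ x ∈ F, law n x := by
    intro n
    rw [law_succ, expect_bind, ← hlawF, ← expect_add, ← expect_const (law n) ε, ← expect_add]
    exact expect_mono fun x _ => hdrift x
  have hsum : ∀ n : ℕ, expect (law n) V + n * ε ≤
      V x₀ + b * ∑ x ∈ F, ∑ k ∈ Finset.range n, law k x := by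
    intro n
    induction n with
    | zero => simp [law, expect_pure]
    | succ n ih =>
      calc expect (law (n + 1)) V + (n + 1 : ℕ) * ε
          = expect (law (n + 1)) V + ε + n * ε := by push_cast; ring
        _ ≤ expect (law n) V + b * ∑ x ∈ F, law n x + n * ε := add_le_add (hstep n) le_rfl
        _ = expect (law n) V + n * ε + b * ∑ x ∈ F, law n x := by ring
        _ ≤ V x₀ + b * ∑ x ∈ F, ∑ k ∈ Finset.range n, law k x + b * ∑ x ∈ F, law n x := by
          gcongr
        _ = _ := by simp only [Finset.sum_range_succ, Finset.sum_add_distrib]; ring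
  have havgF : ∀ n : ℕ, n ≠ 0 → ε ≤ V x₀ * (n : ℝ≥0∞)⁻¹ + b * ∑ x ∈ F, avg n x := by
    intro n hn
    have hn' : (n : ℝ≥0∞) ≠ 0 := by exact_mod_cast hn
    calc ε = (n : ℝ≥0∞)⁻¹ * (n * ε) := by
          rw [← mul_assoc, ENNReal.inv_mul_cancel hn' (ENNReal.natCast_ne_top n), one_mul]
      _ ≤ (n : ℝ≥0∞)⁻¹ * (V x₀ + b * ∑ x ∈ F, ∑ k ∈ Finset.range n, law k x) := by
          gcongr; exact le_trans le_add_self (hsum n)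
      _ = _ := by simp only [avg, ← Finset.mul_sum]; ring
  -- limit along an ultrafilter
  let U : Ultrafilter ℕ := hyperfilter ℕ
  have hU : (U : Filter ℕ) ≤ atTop := Nat.hyperfilter_le_atTop
  have hlim : ∀ x, ∃ l, Tendsto (fun n => avg n x) U (𝓝 l) := fun x =>
    ⟨_, (U.map fun n => avg n x).le_nhds_lim⟩
  choose μ hμ using hlim
  have hinv : Tendsto (fun n : ℕ => (n : ℝ≥0∞)⁻¹) U (𝓝 0) :=
    ENNReal.tendsto_inv_nat_nhds_zero.mono_left hU
  have hne : ∀ᶠ n : ℕ in U, n ≠ 0 := (eventually_ne_atTop 0).filter_mono hU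
  have hsumle : ∀ (n : ℕ) (g : X → ℝ≥0∞) (T : Finset X),
      ∑ x ∈ T, avg n x * g x ≤ (n : ℝ≥0∞)⁻¹ * ∑ k ∈ Finset.range n, expect (law k) g := by
    intro n g T
    simp only [avg, mul_assoc, Finset.sum_mul]
    rw [← Finset.mul_sum, Finset.sum_comm]
    gcongr
    exact ENNReal.sum_le_tsum T
  have hμ1 : ∑' x, μ x ≤ 1 := by
    rw [ENNReal.tsum_eq_iSup_sum]
    refine iSup_le fun T => ?_
    refine le_of_tendsto (tendsto_finsetSum T fun x _ => hμ x) ?_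
    filter_upwards [hne] with n hn
    have h := hsumle n (fun _ => 1) T
    simp only [mul_one, expect_const, Finset.sum_const, Finset.card_range, nsmul_eq_mul] at h
    rwa [ENNReal.inv_mul_cancel (by exact_mod_cast hn) (ENNReal.natCast_ne_top n)] at h
  -- Passing to the limit in finite partial sums yields only an inequality, since mass may escape to
  -- infinity. Shifting the Cesàro average by one step costs at most 1/n.
  have hμK : ∀ y, ∑' x, μ x * K x y ≤ μ y := by
    intro y
    rw [ENNReal.tsum_eq_iSup_sum]
    refine iSup_le fun T => ?_
    have h1 : Tendsto (fun n => ∑ x ∈ T, avg n x * K x y) U (𝓝 (∑ x ∈ T, μ x * K x y)) :=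
      tendsto_finsetSum T fun x _ =>
        ENNReal.Tendsto.mul_const (hμ x) (Or.inr (PMF.apply_ne_top _ _))
    have h2 : Tendsto (fun n : ℕ => avg n y + (n : ℝ≥0∞)⁻¹) U (𝓝 (μ y + 0)) := (hμ y).add hinv
    rw [add_zero] at h2
    refine le_of_tendsto_of_tendsto' h1 h2 fun n => (hsumle n (fun x => K x y) T).trans ?_
    have h3 : ∀ k, expect (law k) (fun x => K x y) = law (k + 1) y := fun k => by
      rw [law_succ, PMF.bind_apply, expect]
    simp only [h3, avg]
    calc (n : ℝ≥0∞)⁻¹ * ∑ k ∈ Finset.range n, law (k + 1) y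
        ≤ (n : ℝ≥0∞)⁻¹ * (∑ k ∈ Finset.range n, law (k + 1) y + law 0 y) := by
          gcongr; exact le_self_add
      _ = (n : ℝ≥0∞)⁻¹ * (∑ k ∈ Finset.range n, law k y + law n y) := by
          rw [← Finset.sum_range_succ' fun k => law k y, Finset.sum_range_succ]
      _ ≤ (n : ℝ≥0∞)⁻¹ * (∑ k ∈ Finset.range n, law k y + 1) := by
          gcongr; exact PMF.coe_le_one _ _
      _ = _ := by rw [mul_add, mul_one]
  -- The drift forces the averages to keep a fixed mass on the finite set `F`, so the limit is
  -- nonzero and can be normalized.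
  have hμF : ε ≤ b * ∑ x ∈ F, μ x := by
    have h : Tendsto (fun n : ℕ => V x₀ * (n : ℝ≥0∞)⁻¹ + b * ∑ x ∈ F, avg n x) U
        (𝓝 (V x₀ * 0 + b * ∑ x ∈ F, μ x)) :=
      (ENNReal.Tendsto.const_mul hinv (Or.inr hx₀)).add
        (ENNReal.Tendsto.const_mul (tendsto_finsetSum F fun x _ => hμ x) (Or.inr hb))
    rw [mul_zero, zero_add] at h
    exact ge_of_tendsto h (hne.mono havgF)
  have hμ0 : ∑' x, μ x ≠ 0 := by
    intro h0
    have : ∑ x ∈ F, μ x = 0 := le_antisymm ((ENNReal.sum_le_tsum F).trans h0.le) zero_le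
    rw [this, mul_zero] at hμF
    exact hε (le_antisymm hμF zero_le)
  have hμtop : ∑' x, μ x ≠ ∞ := ne_top_of_le_ne_top ENNReal.one_ne_top hμ1
  refine ⟨PMF.normalize μ hμ0 hμtop, eq_of_pmf_le fun y => ?_⟩
  simp only [PMF.bind_apply, PMF.normalize_apply, mul_right_comm _ (∑' x, μ x)⁻¹]
  rw [ENNReal.tsum_mul_right]
  gcongr
  exact hμK y

end Invariance

end TaskExpert

namespace TaskExpert

namespace System

variable {C S : Type} [Fintype C] [Fintype S] {sys : System C S}

/-! ### From continuous time to the chain at its events. -/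

section Stationarity

variable (P : sys.Policy)

theorem bind_stepIter_of_invariant {q : PMF (sys.State × P.Mem)} (hq : q.bind P.step = q) (k : ℕ) :
    q.bind (P.stepIter k) = q := by
  induction k with
  | zero => exact PMF.bind_pure q
  | succ k ih =>
    change (q.bind fun x => (P.step x).bind (P.stepIter k)) = q
    rw [← PMF.bind_bind, hq, ih]

open Real in
/-- A stationary distribution of the continuous-time chain is the same as an invariant distribution
of the chain observed at the events. -/
theorem stabilizes_iff :
    P.Stabilizes ↔ ∃ q : PMF (sys.State × P.Mem), q.bind P.step = q := by
  refine exists_congr fun q => ⟨fun h => eq_of_pmf_le fun y => ?_, fun hq t => ?_⟩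
  · let r : ℕ → ℝ≥0∞ := fun k => q.bind (P.stepIter k) y
    have hr0 : r 0 = q y := by
      change q.bind PMF.pure y = q y
      rw [PMF.bind_pure]
    have hr1 : r 1 = q.bind P.step y := by
      change (q.bind fun x => (P.step x).bind PMF.pure) y = _
      simp only [PMF.bind_pure]
    rw [← hr0, ← hr1]
    have hrtop : ∀ k, r k ≠ ∞ := fun k => PMF.apply_ne_top _ _
    -- Take a time at which the mean number of events is θ and keep only the Poisson terms k = 0, 1.
    -- This gives θ * r 1 ≤ (exp θ - 1) * r 0, and exp θ - 1 ≤ θ + θ².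
    have key : ∀ θ : ℝ, 0 < θ → θ ≤ 1 → (r 1).toReal - (r 0).toReal ≤ θ := by
      intro θ hθ hθ1
      have hΛ := sys.totalRate_pos
      have hmean : sys.totalRate.toNNReal * (θ / sys.totalRate).toNNReal = θ.toNNReal := by
        rw [← Real.toNNReal_mul hΛ.le, mul_div_cancel₀ _ hΛ.ne']
      have h1 := h (θ / sys.totalRate).toNNReal
      unfold Policy.transition at h1
      rw [PMF.bind_comm] at h1
      have h2 := DFunLike.congr_fun h1 y
      rw [PMF.bind_apply, ← hr0] at h2
      have h3 := (ENNReal.sum_le_tsum (Finset.range 2)).trans h2.le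
      simp only [Finset.sum_range_succ, Finset.sum_range_zero, zero_add,
        MeasureTheory.Measure.toPMF_apply, ProbabilityTheory.poissonMeasure_singleton, hmean,
        Real.coe_toNNReal θ hθ.le, pow_zero, pow_one, mul_one, Nat.factorial, Nat.cast_one,
        div_one] at h3
      have h4 := ENNReal.toReal_mono (hrtop 0) h3
      rw [ENNReal.toReal_add (ENNReal.mul_ne_top ENNReal.ofReal_ne_top (hrtop 0))
        (ENNReal.mul_ne_top ENNReal.ofReal_ne_top (hrtop 1)), ENNReal.toReal_mul,
        ENNReal.toReal_mul, ENNReal.toReal_ofReal (exp_pos _).le,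
        ENNReal.toReal_ofReal (mul_pos (exp_pos _) hθ).le] at h4
      have hr : (r 0).toReal ≤ 1 :=
        ENNReal.toReal_mono ENNReal.one_ne_top (PMF.coe_le_one _ _)
      have hr' : 0 ≤ (r 0).toReal := ENNReal.toReal_nonneg
      have h5 : exp (-θ) * exp θ = 1 := by rw [← exp_add]; simp
      have h6 : exp θ - 1 - θ ≤ θ ^ 2 := (le_abs_self _).trans
        (abs_exp_sub_one_sub_id_le (by rwa [abs_of_pos hθ]))
      have h7 : (r 0).toReal + θ * (r 1).toReal ≤ exp θ * (r 0).toReal := by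
        calc (r 0).toReal + θ * (r 1).toReal
            = exp θ * (exp (-θ) * (r 0).toReal + exp (-θ) * θ * (r 1).toReal) := by
              linear_combination (-(r 0).toReal - θ * (r 1).toReal) * h5
          _ ≤ _ := by gcongr
      have h8 : θ * ((r 1).toReal - (r 0).toReal) ≤ θ * θ := by nlinarith
      exact le_of_mul_le_mul_left h8 hθ
    refine (ENNReal.toReal_le_toReal (hrtop 1) (hrtop 0)).1 ?_
    by_contra! hlt
    have hθ : 0 < min 1 (((r 1).toReal - (r 0).toReal) / 2) :=
      lt_min one_pos (by linarith)
    have := key _ hθ (min_le_left _ _)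
    linarith [min_le_right 1 (((r 1).toReal - (r 0).toReal) / 2)]
  · unfold Policy.transition
    rw [PMF.bind_comm]
    simp only [bind_stepIter_of_invariant P hq, PMF.bind_const]

end Stationarity

/-! ### One-step expectations and increments. -/

section Step

/-- Expected value of a function of the vector `N` after the service clock of expert `s` rings
while he works on `w`. -/
noncomputable def attemptValue (g : sys.State → ℝ≥0∞) (n : sys.State) (s : S) :
    Option sys.Z → ℝ≥0∞
  | none => g n
  | some z =>
    ENNReal.ofReal (sys.psi s z) * g (n - Finsupp.single z 1 + Finsupp.single (sys.phi s z) 1) +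
      ENNReal.ofReal (1 - sys.psi s z) * g (n - Finsupp.single z 1)

theorem expect_step (P : sys.Policy) (x : sys.State × P.Mem) (g : sys.State → ℝ≥0∞) :
    expect (P.step x) (fun y => g y.1) =
      ENNReal.ofReal (sys.arrivalRate / sys.totalRate) *
        expect sys.prior (fun z => g (x.1 + Finsupp.single z 1)) +
      ∑ s, ENNReal.ofReal (sys.rate s / sys.totalRate) *
        expect (P.assign x.1 x.2 s) (attemptValue g x.1 s) := by
  rw [Policy.step, expect_bind, expect_fintype, Fintype.sum_option]
  congr 1
  · simp only [expect_bind, expect_map, expect_const]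
    rfl
  · refine Finset.sum_congr rfl fun s _ => ?_
    change ENNReal.ofReal (sys.rate s / sys.totalRate) * _ = _
    congr 1
    dsimp only
    rw [expect_bind]
    congr 1
    funext w
    cases w with
    | none => simp only [expect_map, expect_const, attemptValue]
    | some z =>
      simp only [expect_bind]
      rw [expect_fintype, Fintype.sum_bool]
      simp only [failureLaw, PMF.ofFintype_apply, if_true, Bool.false_eq_true, if_false,
        expect_map, expect_const, attemptValue]

theorem step_increment (P : sys.Policy) {x y : sys.State × P.Mem} (h : P.step x y ≠ 0)
    (z : sys.Z) : y.1 z ≤ x.1 z + 1 ∧ x.1 z ≤ y.1 z + 1 := by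
  classical
  rw [← PMF.mem_support_iff, Policy.step, PMF.mem_support_bind_iff] at h
  obtain ⟨e, -, h⟩ := h
  cases e with
  | none =>
    simp only [PMF.mem_support_bind_iff, PMF.mem_support_map_iff] at h
    obtain ⟨w, -, m, -, rfl⟩ := h
    simp only [Finsupp.add_apply, Finsupp.single_apply]
    split_ifs <;> omega
  | some s =>
    simp only [PMF.mem_support_bind_iff] at h
    obtain ⟨w, -, h⟩ := h
    cases w with
    | none =>
      simp only [PMF.mem_support_map_iff] at h
      obtain ⟨m, -, rfl⟩ := h
      simp
    | some w =>
      simp only [PMF.mem_support_bind_iff] at h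
      obtain ⟨b, -, h⟩ := h
      cases b <;> simp only [if_true, Bool.false_eq_true, if_false, PMF.mem_support_map_iff] at h <;>
        obtain ⟨m, -, rfl⟩ := h <;>
        simp only [Finsupp.add_apply, Finsupp.tsub_apply, Finsupp.single_apply] <;>
        split_ifs <;> omega

end Step

end System

end TaskExpert

namespace TaskExpert

open TaskExpert.System

/-! ### The two-type system, its counts and the drift criteria in terms of them. -/

section Asymmetric

variable {a lam : ℝ} {ha₀ : 0 < a} {ha₁ : a < 1} {hlam : 0 < lam}

local notation "sys" => asymmetric a lam ha₀ ha₁ hlam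

/-- The mixed type `z'` in the Asymmetric(a) system. -/
noncomputable def zNew : (asymmetric a lam ha₀ ha₁ hlam).Z := ⟨mixedNew, Or.inl rfl⟩

/-- The mixed type `z''` in the Asymmetric(a) system. -/
noncomputable def zFailed : (asymmetric a lam ha₀ ha₁ hlam).Z := ⟨mixedFailed, Or.inr rfl⟩

theorem zNew_ne_zFailed : (zNew : (sys).Z) ≠ zFailed := by
  intro h
  have := congrFun (congrArg Subtype.val h) 0
  norm_num [zNew, zFailed, mixedNew, mixedFailed] at this

theorem eq_zNew_or_zFailed (z : (sys).Z) : z = zNew ∨ z = zFailed := by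
  obtain ⟨z, rfl | rfl⟩ := z
  · exact Or.inl rfl
  · exact Or.inr rfl

theorem psi_zero_zNew : (sys).psi 0 zNew = (1 - a) / 2 := by
  simp [psi, failureProb, asymmetric, asymmetricP, zNew, mixedNew]; ring

theorem psi_one_zNew : (sys).psi 1 zNew = 1 / 2 := by
  simp [psi, failureProb, asymmetric, asymmetricP, zNew, mixedNew]

theorem psi_zero_zFailed : (sys).psi 0 zFailed = 1 - a := by
  simp [psi, failureProb, asymmetric, asymmetricP, zFailed, mixedFailed]

theorem psi_one_zFailed : (sys).psi 1 zFailed = 1 := by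
  simp [psi, failureProb, asymmetric, asymmetricP, zFailed, mixedFailed]

theorem psi_pos (s : Fin 2) (z : (sys).Z) : 0 < (sys).psi s z := by
  obtain rfl | rfl := eq_zNew_or_zFailed z <;> fin_cases s
  · exact psi_zero_zNew.trans_gt (by linarith)
  · exact psi_one_zNew.trans_gt (by norm_num)
  · exact psi_zero_zFailed.trans_gt (by linarith)
  · exact psi_one_zFailed.trans_gt one_pos

/-- No expert ever fails on a task of type c₁, so any failure reveals c₂. -/
theorem phi_eq (s : Fin 2) (z : (sys).Z) : (sys).phi s z = zFailed := by
  have h : failureProb (sys).p s z ≠ 0 := (psi_pos s z).ne'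
  rw [phi, dif_pos h]
  refine Subtype.ext (funext fun c => ?_)
  have h1 : 1 - a ≠ 0 := by linarith
  obtain rfl | rfl := eq_zNew_or_zFailed z <;> fin_cases s <;> fin_cases c <;>
    simp [posterior, failureProb, asymmetric, asymmetricP, zNew, zFailed, mixedNew, mixedFailed, h1]

theorem totalRate_eq : (sys).totalRate = lam + 2 := by
  simp [totalRate, Fintype.sum_option, clockRate, asymmetric]

/-- A nonnegative function of the numbers of outstanding tasks of the two mixed types, as a
function of the vector `N`. -/
noncomputable def ofCounts (v : ℕ → ℕ → ℝ) (n : (asymmetric a lam ha₀ ha₁ hlam).State) : ℝ≥0∞ :=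
  ENNReal.ofReal (v (n zNew) (n zFailed))

variable {v : ℕ → ℕ → ℝ}

theorem attemptValue_zNew (hv : ∀ i j, 0 ≤ v i j) (n : (sys).State) (s : Fin 2) :
    attemptValue (ofCounts v) n s (some zNew) = ENNReal.ofReal
      ((sys).psi s zNew * v (n zNew - 1) (n zFailed + 1) +
        (1 - (sys).psi s zNew) * v (n zNew - 1) (n zFailed)) := by
  have h1 := psi_pos s (zNew : (sys).Z)
  have h2 := (sys).psi_le_one s zNew
  have h3 := zNew_ne_zFailed (ha₀ := ha₀) (ha₁ := ha₁) (hlam := hlam)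
  rw [ENNReal.ofReal_add (mul_nonneg h1.le (hv _ _)) (mul_nonneg (by linarith) (hv _ _)),
    ENNReal.ofReal_mul h1.le, ENNReal.ofReal_mul (by linarith)]
  simp [attemptValue, ofCounts, phi_eq, h3, h3.symm]

/-- A failure removes the task and puts it back under the same mixed type; with truncated
subtraction this restores `n` only if the count is positive. -/
theorem attemptValue_zFailed (hv : ∀ i j, 0 ≤ v i j) {n : (sys).State} (hn : 0 < n zFailed)
    (s : Fin 2) :
    attemptValue (ofCounts v) n s (some zFailed) = ENNReal.ofReal
      ((sys).psi s zFailed * v (n zNew) (n zFailed) +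
        (1 - (sys).psi s zFailed) * v (n zNew) (n zFailed - 1)) := by
  have h1 := psi_pos s (zFailed : (sys).Z)
  have h2 := (sys).psi_le_one s zFailed
  have h3 := zNew_ne_zFailed (ha₀ := ha₀) (ha₁ := ha₁) (hlam := hlam)
  rw [ENNReal.ofReal_add (mul_nonneg h1.le (hv _ _)) (mul_nonneg (by linarith) (hv _ _)),
    ENNReal.ofReal_mul h1.le, ENNReal.ofReal_mul (by linarith)]
  simp [attemptValue, ofCounts, phi_eq, h3, Nat.sub_add_cancel hn]

theorem expect_step_ofCounts (P : (sys).Policy) (x : (sys).State × P.Mem) :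
    expect (P.step x) (fun y => ofCounts v y.1) =
      ENNReal.ofReal (lam / (lam + 2)) *
        ENNReal.ofReal (v (x.1 zNew + 1) (x.1 zFailed)) +
      (ENNReal.ofReal (1 / (lam + 2)) * expect (P.assign x.1 x.2 0) (attemptValue (ofCounts v) x.1 0)
      + ENNReal.ofReal (1 / (lam + 2)) *
        expect (P.assign x.1 x.2 1) (attemptValue (ofCounts v) x.1 1)) := by
  rw [expect_step, Fin.sum_univ_two, totalRate_eq]
  congr 2
  change expect (PMF.pure zNew) _ = _
  rw [expect_pure]
  simp [ofCounts, zNew_ne_zFailed.symm]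

theorem expect_step_le (hv : ∀ i j, 0 ≤ v i j) (P : (sys).Policy) (x : (sys).State × P.Mem)
    {r₀ r₁ : ℝ} (hr₀ : 0 ≤ r₀) (hr₁ : 0 ≤ r₁)
    (h₀ : expect (P.assign x.1 x.2 0) (attemptValue (ofCounts v) x.1 0) ≤ ENNReal.ofReal r₀)
    (h₁ : expect (P.assign x.1 x.2 1) (attemptValue (ofCounts v) x.1 1) ≤ ENNReal.ofReal r₁) :
    expect (P.step x) (fun y => ofCounts v y.1) ≤
      ENNReal.ofReal ((lam * v (x.1 zNew + 1) (x.1 zFailed) + r₀ + r₁) / (lam + 2)) := by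
  have hL : 0 < lam + 2 := by linarith
  have := hv (x.1 zNew + 1) (x.1 zFailed)
  rw [expect_step_ofCounts, add_div, add_div, mul_div_right_comm, div_eq_mul_one_div r₀,
    div_eq_mul_one_div r₁, mul_comm r₀, mul_comm r₁, add_assoc,
    ENNReal.ofReal_add (by positivity) (by positivity),
    ENNReal.ofReal_add (by positivity) (by positivity), ENNReal.ofReal_mul (by positivity),
    ENNReal.ofReal_mul (by positivity), ENNReal.ofReal_mul (by positivity)]
  gcongr

theorem le_expect_step (P : (sys).Policy) (x : (sys).State × P.Mem) {r₀ r₁ : ℝ}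
    (h₀ : ENNReal.ofReal r₀ ≤ expect (P.assign x.1 x.2 0) (attemptValue (ofCounts v) x.1 0))
    (h₁ : ENNReal.ofReal r₁ ≤ expect (P.assign x.1 x.2 1) (attemptValue (ofCounts v) x.1 1)) :
    ENNReal.ofReal ((lam * v (x.1 zNew + 1) (x.1 zFailed) + r₀ + r₁) / (lam + 2)) ≤
      expect (P.step x) (fun y => ofCounts v y.1) := by
  have hL : 0 < lam + 2 := by linarith
  rw [expect_step_ofCounts, add_div, add_div, mul_div_right_comm, div_eq_mul_one_div r₀,
    div_eq_mul_one_div r₁, mul_comm r₀, mul_comm r₁, add_assoc]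
  refine ENNReal.ofReal_add_le.trans (add_le_add ?_ (ENNReal.ofReal_add_le.trans ?_)) <;>
    rw [ENNReal.ofReal_mul (by positivity)]
  rw [ENNReal.ofReal_mul (by positivity)]
  gcongr

/-- A policy with a Lyapunov function whose drift is negative outside a bounded set of vectors `N`
stabilizes the system. -/
theorem stabilizes_of_drift (P : (sys).Policy) [Finite P.Mem] (m₀ : P.Mem)
    (hv : ∀ i j, 0 ≤ v i j) (ε b : ℝ) (hε : 0 < ε) (hb : 0 ≤ b) (M : ℕ)
    (hdrift : ∀ x : (sys).State × P.Mem, ∃ r₀ r₁ : ℝ, 0 ≤ r₀ ∧ 0 ≤ r₁ ∧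
      expect (P.assign x.1 x.2 0) (attemptValue (ofCounts v) x.1 0) ≤ ENNReal.ofReal r₀ ∧
      expect (P.assign x.1 x.2 1) (attemptValue (ofCounts v) x.1 1) ≤ ENNReal.ofReal r₁ ∧
      lam * v (x.1 zNew + 1) (x.1 zFailed) + r₀ + r₁ + ε ≤
        (lam + 2) * v (x.1 zNew) (x.1 zFailed) +
          if x.1 zNew + x.1 zFailed ≤ M then b else 0) :
    P.Stabilizes := by
  have hL : 0 < lam + 2 := by linarith
  have hF : {x : (sys).State × P.Mem | x.1 zNew + x.1 zFailed ≤ M}.Finite := by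
    refine Set.Finite.of_finite_image (f := fun x => ((x.1 zNew, x.1 zFailed), x.2))
      (((Set.finite_Iic (M, M)).prod (Set.finite_univ (α := P.Mem))).subset ?_) ?_
    · rintro _ ⟨x, hx, rfl⟩
      have hx' : x.1 zNew + x.1 zFailed ≤ M := hx
      exact ⟨⟨by simp only; omega, by simp only; omega⟩, trivial⟩
    · rintro ⟨n, m⟩ - ⟨n', m'⟩ - h
      simp only [Prod.mk.injEq] at h
      refine Prod.ext (Finsupp.ext fun z => ?_) h.2
      obtain rfl | rfl := eq_zNew_or_zFailed z
      exacts [h.1.1, h.1.2]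
  refine (stabilizes_iff P).2 (exists_invariant_of_drift P.step (fun x => ofCounts v x.1)
    hF.toFinset (ENNReal.ofReal (ε / (lam + 2))) (ENNReal.ofReal (b / (lam + 2)))
    (ENNReal.ofReal_pos.2 (by positivity)).ne' ENNReal.ofReal_ne_top (x₀ := (0, m₀))
    ENNReal.ofReal_ne_top fun x => ?_)
  obtain ⟨r₀, r₁, hr₀, hr₁, h₀, h₁, h⟩ := hdrift x
  have hvx := hv (x.1 zNew + 1) (x.1 zFailed)
  have hind : Set.indicator (hF.toFinset : Set ((sys).State × P.Mem))
      (fun _ => ENNReal.ofReal (b / (lam + 2))) x =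
      ENNReal.ofReal ((if x.1 zNew + x.1 zFailed ≤ M then b else 0) / (lam + 2)) := by
    by_cases hx : x.1 zNew + x.1 zFailed ≤ M <;> simp [Set.indicator, hx]
  have hb' : 0 ≤ if x.1 zNew + x.1 zFailed ≤ M then b else 0 := by split_ifs <;> simp [hb]
  rw [hind, ofCounts, ← ENNReal.ofReal_add (hv _ _) (by positivity)]
  refine (add_le_add (expect_step_le hv P x hr₀ hr₁ h₀ h₁) le_rfl).trans ?_
  rw [← ENNReal.ofReal_add (by positivity) (by positivity), ← add_div]
  refine ENNReal.ofReal_le_ofReal ?_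
  rw [div_le_iff₀ hL, add_mul, div_mul_cancel₀ _ hL.ne']
  linarith

/-- Under a stationary regime, a linear function whose drift is bounded below by a nonnegative
function `d` has `d = 0` at every state of positive probability. -/
theorem drift_eq_zero_of_stationary (P : (sys).Policy) {q : PMF ((sys).State × P.Mem)}
    (hq : q.bind P.step = q) {α β : ℝ} (hα : 0 ≤ α) (hβ : 0 ≤ β)
    (d : (sys).State → ℝ) (hd : ∀ n, 0 ≤ d n)
    (hdrift : ∀ x : (sys).State × P.Mem, ∃ c₀ c₁ : ℝ, d x.1 ≤ lam * α - c₀ - c₁ ∧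
      ENNReal.ofReal (α * x.1 zNew + β * x.1 zFailed - c₀) ≤ expect (P.assign x.1 x.2 0)
        (attemptValue (ofCounts fun i j => α * i + β * j) x.1 0) ∧
      ENNReal.ofReal (α * x.1 zNew + β * x.1 zFailed - c₁) ≤ expect (P.assign x.1 x.2 1)
        (attemptValue (ofCounts fun i j => α * i + β * j) x.1 1))
    {x : (sys).State × P.Mem} (hx : q x ≠ 0) : d x.1 = 0 := by
  have hL : 0 < lam + 2 := by linarith
  have h := drift_eq_zero_of_invariant hq (fun x => α * x.1 zNew + β * x.1 zFailed)
    (fun x => d x.1 / (lam + 2)) (α + β) (by positivity) (fun x => by positivity) ?_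
    (fun x => div_nonneg (hd _) hL.le) ?_ hx
  · simpa [hL.ne'] using h
  · intro x y hxy
    have h1 := step_increment P hxy zNew
    have h2 := step_increment P hxy zFailed
    have e1 : |(y.1 zNew : ℝ) - x.1 zNew| ≤ 1 := by
      rw [abs_le]
      have h3 : (y.1 zNew : ℝ) ≤ x.1 zNew + 1 := by exact_mod_cast h1.1
      have h4 : (x.1 zNew : ℝ) ≤ y.1 zNew + 1 := by exact_mod_cast h1.2
      constructor <;> linarith
    have e2 : |(y.1 zFailed : ℝ) - x.1 zFailed| ≤ 1 := by
      rw [abs_le]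
      have h3 : (y.1 zFailed : ℝ) ≤ x.1 zFailed + 1 := by exact_mod_cast h2.1
      have h4 : (x.1 zFailed : ℝ) ≤ y.1 zFailed + 1 := by exact_mod_cast h2.2
      constructor <;> linarith
    rw [abs_le] at e1 e2 ⊢
    constructor <;> nlinarith
  · intro x
    obtain ⟨c₀, c₁, hd, h₀, h₁⟩ := hdrift x
    refine le_trans (ENNReal.ofReal_le_ofReal ?_) (le_expect_step P x h₀ h₁)
    rw [le_div_iff₀ hL, add_mul, div_mul_cancel₀ _ hL.ne']
    push_cast
    linarith

end Asymmetric

end TaskExpert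

namespace TaskExpert

open TaskExpert.System

/-! ### The exact stability threshold of Preemptive Greedy. -/

section Greedy

variable {a lam : ℝ} {ha₀ : 0 < a} {ha₁ : a < 1} {hlam : 0 < lam}

local notation "sys" => asymmetric a lam ha₀ ha₁ hlam

/-- Both experts strictly prefer z' to z'', so in a nonempty system the greedy set is a singleton
and tie-breaking never acts. -/
theorem greedyAssign_of_greedySet_eq {n : (sys).State} {s : Fin 2} {z : (sys).Z}
    (h : (sys).greedySet n s = {z}) : (sys).greedyAssign n s = PMF.pure (some z) := by
  have hn : n ≠ 0 := by
    rintro rfl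
    have := h ▸ Finset.mem_singleton_self z
    simp [greedySet] at this
  have hu : PMF.uniformOfFinset _ ((sys).greedySet_nonempty hn s) = PMF.pure z := by
    refine PMF.ext fun w => ?_
    simp [PMF.uniformOfFinset_apply, PMF.pure_apply, h]
  rw [greedyAssign, dif_neg hn, hu, PMF.pure_map]

theorem greedyAssign_of_zNew_pos {n : (sys).State} (hn : 0 < n zNew) (s : Fin 2) :
    (sys).greedyAssign n s = PMF.pure (some zNew) := by
  have hlt : (sys).psi s zNew < (sys).psi s zFailed := by
    fin_cases s
    · exact (psi_zero_zNew.trans_lt (by linarith)).trans_eq psi_zero_zFailed.symm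
    · exact (psi_one_zNew.trans_lt (by norm_num)).trans_eq psi_one_zFailed.symm
  refine greedyAssign_of_greedySet_eq (Finset.ext fun z => ?_)
  simp only [greedySet, Finset.mem_filter, Finsupp.mem_support_iff, Finset.mem_singleton]
  constructor
  · rintro ⟨-, h⟩
    refine (eq_zNew_or_zFailed z).resolve_right ?_
    rintro rfl
    exact (h zNew hn.ne').not_gt hlt
  · rintro rfl
    refine ⟨hn.ne', fun w _ => ?_⟩
    obtain rfl | rfl := eq_zNew_or_zFailed w
    exacts [le_rfl, hlt.le]

theorem greedyAssign_of_zFailed_pos {n : (sys).State} (hn : n zNew = 0) (hn' : 0 < n zFailed)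
    (s : Fin 2) : (sys).greedyAssign n s = PMF.pure (some zFailed) := by
  have hmem : ∀ z, n z ≠ 0 ↔ z = zFailed := by
    intro z
    obtain rfl | rfl := eq_zNew_or_zFailed z
    · simp [hn, zNew_ne_zFailed]
    · simp [hn'.ne']
  refine greedyAssign_of_greedySet_eq (Finset.ext fun z => ?_)
  simp only [greedySet, Finset.mem_filter, Finsupp.mem_support_iff, Finset.mem_singleton, hmem]
  exact ⟨fun h => h.1, fun h => ⟨h, fun w hw => by rw [h, hw]⟩⟩

theorem eq_zero_of_counts_eq_zero {n : (sys).State} (hn : n zNew = 0) (hn' : n zFailed = 0) :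
    n = 0 := by
  refine Finsupp.ext fun z => ?_
  obtain rfl | rfl := eq_zNew_or_zFailed z
  exacts [hn, hn']

theorem greedyAssign_of_counts_eq_zero {n : (sys).State} (hn : n zNew = 0) (hn' : n zFailed = 0)
    (s : Fin 2) : (sys).greedyAssign n s = PMF.pure none := by
  rw [greedyAssign, dif_pos (eq_zero_of_counts_eq_zero hn hn')]

theorem preemptiveGreedy_stabilizes (h : lam < 4 * a / (2 + a)) :
    (sys).preemptiveGreedy.Stabilizes := by
  have h' : lam * (2 + a) < 4 * a := (lt_div_iff₀ (by linarith)).1 h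
  have hlam2 : 0 < 2 - lam := by nlinarith
  -- The lower bound makes the drift of c * i + j negative when i > 0, the upper bound when i = 0 <
  -- j.
  obtain ⟨c, hc1, hc2⟩ : ∃ c, (2 - a) / (2 * (2 - lam)) < c ∧ c < a / lam := by
    refine exists_between ?_
    rw [div_lt_div_iff₀ (by linarith) hlam]
    nlinarith
  rw [div_lt_iff₀ (by linarith)] at hc1
  rw [lt_div_iff₀ hlam] at hc2
  have hc : 0 < c := by
    by_contra! hc
    nlinarith
  have : Finite (sys).preemptiveGreedy.Mem := inferInstanceAs (Finite Unit)
  refine stabilizes_of_drift (v := fun i j => c * i + j) (sys).preemptiveGreedy ()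
    (fun i j => by positivity) (min (c * (2 - lam) - (2 - a) / 2) (a - c * lam))
    (lam * c + a) (lt_min (by linarith) (by linarith)) (by positivity) 0 ?_
  rintro ⟨n, m⟩
  have hε₁ := min_le_left (c * (2 - lam) - (2 - a) / 2) (a - c * lam)
  have hε₂ := min_le_right (c * (2 - lam) - (2 - a) / 2) (a - c * lam)
  have hv : ∀ i j : ℕ, 0 ≤ c * i + j := fun i j => by positivity
  have hψ : ∀ s z, 0 ≤ 1 - (sys).psi s z := fun s z => sub_nonneg.2 ((sys).psi_le_one s z)
  simp only [preemptiveGreedy]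
  rcases Nat.eq_zero_or_pos (n zNew) with hi | hi
  · rcases Nat.eq_zero_or_pos (n zFailed) with hj | hj
    · refine ⟨c * n zNew + n zFailed, c * n zNew + n zFailed, hv _ _, hv _ _, ?_, ?_, ?_⟩
      · rw [greedyAssign_of_counts_eq_zero hi hj, expect_pure]; exact le_rfl
      · rw [greedyAssign_of_counts_eq_zero hi hj, expect_pure]; exact le_rfl
      · simp only [hi, hj, if_true, add_zero, le_refl]
        push_cast
        nlinarith
    · have e : ∀ s, expect ((sys).greedyAssign n s)
          (attemptValue (ofCounts fun i j => c * i + j) n s) = ENNReal.ofReal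
          ((sys).psi s zFailed * (c * n zNew + n zFailed) +
            (1 - (sys).psi s zFailed) * (c * n zNew + (n zFailed - 1 : ℕ))) := fun s => by
        rw [greedyAssign_of_zFailed_pos hi hj, expect_pure, attemptValue_zFailed hv hj]
      refine ⟨_, _, ?_, ?_, (e 0).le, (e 1).le, ?_⟩
      rotate_left 2
      · obtain ⟨k, hk⟩ := Nat.exists_eq_add_of_le' hj
        rw [if_neg (by omega)]
        simp only [hi, hk, psi_zero_zFailed, psi_one_zFailed, Nat.add_sub_cancel]
        push_cast
        nlinarith
      · exact add_nonneg (mul_nonneg ((sys).psi_nonneg _ _) (hv _ _))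
          (mul_nonneg (hψ _ _) (hv _ _))
      · exact add_nonneg (mul_nonneg ((sys).psi_nonneg _ _) (hv _ _))
          (mul_nonneg (hψ _ _) (hv _ _))
  · have e : ∀ s, expect ((sys).greedyAssign n s)
        (attemptValue (ofCounts fun i j => c * i + j) n s) = ENNReal.ofReal
        ((sys).psi s zNew * (c * (n zNew - 1 : ℕ) + (n zFailed + 1 : ℕ)) +
          (1 - (sys).psi s zNew) * (c * (n zNew - 1 : ℕ) + n zFailed)) := fun s => by
      rw [greedyAssign_of_zNew_pos hi, expect_pure, attemptValue_zNew hv]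
    refine ⟨_, _, ?_, ?_, (e 0).le, (e 1).le, ?_⟩
    rotate_left 2
    · obtain ⟨k, hk⟩ := Nat.exists_eq_add_of_le' hi
      rw [if_neg (by omega)]
      simp only [hk, psi_zero_zNew, psi_one_zNew, Nat.add_sub_cancel]
      push_cast
      nlinarith
    · exact add_nonneg (mul_nonneg ((sys).psi_nonneg _ _) (hv _ _))
        (mul_nonneg (hψ _ _) (hv _ _))
    · exact add_nonneg (mul_nonneg ((sys).psi_nonneg _ _) (hv _ _))
        (mul_nonneg (hψ _ _) (hv _ _))

theorem preemptiveGreedy_step_ne_zero {n : (sys).State} {z : (sys).Z}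
    (h : (sys).greedyAssign n 0 = PMF.pure (some z)) (u : Unit) :
    (sys).preemptiveGreedy.step (n, u) (n - Finsupp.single z 1, ()) ≠ 0 := by
  have hpsi : (sys).psi 0 z < 1 := by
    obtain rfl | rfl := eq_zNew_or_zFailed z
    · exact psi_zero_zNew.trans_lt (by linarith)
    · exact psi_zero_zFailed.trans_lt (by linarith)
  rw [← PMF.mem_support_iff, Policy.step, PMF.mem_support_bind_iff]
  refine ⟨some 0, ?_, ?_⟩
  · rw [PMF.mem_support_iff, clockLaw, PMF.ofFintype_apply]
    exact (ENNReal.ofReal_pos.2 (div_pos ((sys).clockRate_pos _) (sys).totalRate_pos)).ne'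
  · dsimp only
    rw [PMF.mem_support_bind_iff]
    refine ⟨some z, ?_, ?_⟩
    · change some z ∈ ((sys).greedyAssign n 0).support
      rw [h]
      simp
    · dsimp only
      rw [PMF.mem_support_bind_iff]
      refine ⟨false, ?_, ?_⟩
      · rw [PMF.mem_support_iff, failureLaw, PMF.ofFintype_apply]
        simpa using hpsi
      · simp only [Bool.false_eq_true, if_false, PMF.mem_support_map_iff]
        exact ⟨(), (PMF.mem_support_pure_iff () ()).2 rfl, rfl⟩

/-- From any charged state the first expert can succeed repeatedly, since a > 0 gives him a chance
on both mixed types; each success removes one task. -/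
theorem invariant_zero_ne_zero {q : PMF ((sys).State × Unit)}
    (hq : q.bind (sys).preemptiveGreedy.step = q) : q (0, ()) ≠ 0 := by
  obtain ⟨⟨n, u⟩, hx⟩ := q.support_nonempty
  rw [PMF.mem_support_iff] at hx
  induction hk : n zNew + n zFailed generalizing n u with
  | zero =>
    rwa [eq_zero_of_counts_eq_zero (n := n) (by omega) (by omega)] at hx
  | succ k ih =>
    have hdec : ∀ z, (sys).greedyAssign n 0 = PMF.pure (some z) →
        q (n - Finsupp.single z 1, ()) ≠ 0 :=
      fun z hz => ne_zero_of_invariant hq hx (preemptiveGreedy_step_ne_zero hz u)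
    rcases Nat.eq_zero_or_pos (n zNew) with hi | hi
    · have hj : 0 < n zFailed := by omega
      refine ih _ _ (hdec _ (greedyAssign_of_zFailed_pos hi hj 0)) ?_
      simp [Finsupp.tsub_apply, zNew_ne_zFailed.symm]
      omega
    · refine ih _ _ (hdec _ (greedyAssign_of_zNew_pos hi 0)) ?_
      simp [Finsupp.tsub_apply, zNew_ne_zFailed]
      omega

/-- With weight a/λ on z' and 1 on z'', the drift is 0 when only z'' is present, a at the empty
state, and 1 + a/2 - 2a/λ when z' is present, which is nonnegative when the claimed bound fails. -/
theorem lt_of_preemptiveGreedy_stabilizes (h : (sys).preemptiveGreedy.Stabilizes) :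
    lam < 4 * a / (2 + a) := by
  by_contra! hle
  have hle' : 4 * a ≤ lam * (2 + a) := (div_le_iff₀ (by linarith)).1 hle
  obtain ⟨q, hq⟩ := (stabilizes_iff _).1 h
  have hα : 0 ≤ a / lam := by positivity
  have hlα : lam * (a / lam) = a := mul_div_cancel₀ _ hlam.ne'
  have hα2 : 2 * (a / lam) ≤ 1 + a / 2 := by
    rw [mul_div_assoc', div_le_iff₀ hlam]
    linarith
  have hv : ∀ i j : ℕ, 0 ≤ a / lam * i + 1 * (j : ℝ) := fun i j => by positivity
  have := drift_eq_zero_of_stationary (sys).preemptiveGreedy hq hα zero_le_one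
    (fun n => if n zNew = 0 ∧ n zFailed = 0 then a else 0)
    (fun n => by split_ifs <;> simp [ha₀.le]) ?_ (invariant_zero_ne_zero hq)
  · simp [ha₀.ne'] at this
  · rintro ⟨n, m⟩
    simp only [preemptiveGreedy]
    rcases Nat.eq_zero_or_pos (n zNew) with hi | hi
    · rcases Nat.eq_zero_or_pos (n zFailed) with hj | hj
      · refine ⟨0, 0, ?_, ?_, ?_⟩
        · simp [hi, hj, hlα]
        all_goals
          rw [greedyAssign_of_counts_eq_zero hi hj, expect_pure, sub_zero]
          exact le_rfl
      · refine ⟨a, 0, ?_, ?_, ?_⟩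
        · simp [hj.ne', hlα]
        all_goals
          obtain ⟨k, hk⟩ := Nat.exists_eq_add_of_le' hj
          rw [greedyAssign_of_zFailed_pos hi hj, expect_pure, attemptValue_zFailed hv hj]
          refine ENNReal.ofReal_le_ofReal ?_
          simp only [hi, hk, psi_zero_zFailed, psi_one_zFailed, Nat.add_sub_cancel]
          push_cast
          linarith
    · refine ⟨a / lam - (1 - a) / 2, a / lam - 1 / 2, ?_, ?_, ?_⟩
      · rw [if_neg (by omega), hlα]
        linarith
      all_goals
        obtain ⟨k, hk⟩ := Nat.exists_eq_add_of_le' hi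
        rw [greedyAssign_of_zNew_pos hi, expect_pure, attemptValue_zNew hv]
        refine ENNReal.ofReal_le_ofReal ?_
        simp only [hk, psi_zero_zNew, psi_one_zNew, Nat.add_sub_cancel]
        push_cast
        linarith

end Greedy

/-! ### The optimal throughput, by linear programming duality. -/

section Throughput

variable {a lam : ℝ} {ha₀ : 0 < a} {ha₁ : a < 1} {hlam : 0 < lam}

local notation "sys" => asymmetric a lam ha₀ ha₁ hlam

/-- Weak duality for the throughput: `α` and `β` are values of a task of mixed type `z'` and `z''`,
and `c s` bounds the value that expert `s` can remove per attempt. -/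
theorem mul_le_of_stabilizes {P : (sys).Policy} (hP : P.Stabilizes) {α β : ℝ} (hα : 0 ≤ α)
    (hβ : 0 ≤ β) (c : Fin 2 → ℝ) (hc : ∀ s, 0 ≤ c s)
    (hnew : ∀ s, α - β * (sys).psi s zNew ≤ c s)
    (hfailed : ∀ s, β * (1 - (sys).psi s zFailed) ≤ c s) : lam * α ≤ c 0 + c 1 := by
  obtain ⟨q, hq⟩ := (stabilizes_iff _).1 hP
  obtain ⟨x, hx⟩ := q.support_nonempty
  rw [PMF.mem_support_iff] at hx
  by_contra! hlt
  have hv : ∀ i j : ℕ, 0 ≤ α * i + β * (j : ℝ) := fun i j => by positivity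
  have key : ∀ (x : (sys).State × P.Mem) (s : Fin 2),
      ENNReal.ofReal (α * x.1 zNew + β * x.1 zFailed - c s) ≤ expect (P.assign x.1 x.2 s)
        (attemptValue (ofCounts fun i j => α * i + β * j) x.1 s) := by
    intro x s
    rw [← expect_const (P.assign x.1 x.2 s)
      (ENNReal.ofReal (α * x.1 zNew + β * x.1 zFailed - c s))]
    refine expect_mono fun w hw => ?_
    match w, hw with
    | none, _ => exact ENNReal.ofReal_le_ofReal (by linarith [hc s])
    | some z, hw =>
      have hz := P.outstanding _ _ _ _ hw
      obtain ⟨k, hk⟩ := Nat.exists_eq_add_of_le' hz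
      obtain rfl | rfl := eq_zNew_or_zFailed z
      · rw [attemptValue_zNew hv]
        refine ENNReal.ofReal_le_ofReal ?_
        simp only [hk, Nat.add_sub_cancel]
        push_cast
        linarith [hnew s]
      · rw [attemptValue_zFailed hv hz]
        refine ENNReal.ofReal_le_ofReal ?_
        simp only [hk, Nat.add_sub_cancel]
        push_cast
        linarith [hfailed s]
  -- If the bound failed, this constant would be a positive lower bound for the drift at every
  -- state.
  have := drift_eq_zero_of_stationary P hq hα hβ (fun _ => lam * α - c 0 - c 1)
    (fun _ => by linarith) (fun x => ⟨c 0, c 1, le_rfl, key x 0, key x 1⟩) hx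
  linarith

/-- The values (1/2, 1) price the second expert's work at 0 and give 2a; the values ((1 + a)/2, 1)
make the first expert indifferent between z' and z'' and give 3a/(1 + a). -/
theorem le_of_isStabilizable (h : (sys).IsStabilizable) : lam ≤ min (2 * a) (3 * a / (1 + a)) := by
  obtain ⟨P, hP⟩ := h
  refine le_min ?_ ((le_div_iff₀ (by linarith)).2 ?_)
  · have := mul_le_of_stabilizes hP (α := 1 / 2) (β := 1) (by norm_num) zero_le_one ![a, 0]
      (by intro s; fin_cases s <;> simp [ha₀.le])
      (by
        rw [Fin.forall_fin_two, psi_zero_zNew, psi_one_zNew]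
        constructor <;> norm_num <;> linarith)
      (by
        rw [Fin.forall_fin_two, psi_zero_zFailed, psi_one_zFailed]
        constructor <;> simp)
    simp at this
    linarith
  · have := mul_le_of_stabilizes hP (α := (1 + a) / 2) (β := 1) (by linarith) zero_le_one
      ![a, a / 2]
      (by rw [Fin.forall_fin_two]; constructor <;> simp <;> linarith)
      (by
        rw [Fin.forall_fin_two, psi_zero_zNew, psi_one_zNew]
        constructor <;> norm_num <;> linarith)
      (by
        rw [Fin.forall_fin_two, psi_zero_zFailed, psi_one_zFailed]
        constructor <;> simp <;> linarith)
    simp at this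
    linarith

/-- Law of a biased coin. -/
noncomputable def coin (x : Set.Icc (0 : ℝ) 1) : PMF Bool :=
  PMF.ofFintype
    (fun b => if b then ENNReal.ofReal x else ENNReal.ofReal (1 - x))
    (by
      simp only [Fintype.sum_bool, if_true, Bool.false_eq_true, if_false]
      rw [← ENNReal.ofReal_add x.2.1 (sub_nonneg.2 x.2.2)]
      simp)

/-- The mixed type `z` if there is an outstanding task of that type, and otherwise idling. -/
def serve {Z : Type} (n : Z →₀ ℕ) (z : Z) : Option Z := if n z = 0 then none else some z

/-- The static policy: whenever his service clock rings, expert `s` works on mixed type `z'` with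
probability `x s`, and on `z''` otherwise, idling when there is no such task. -/
noncomputable def staticPolicy (x : Fin 2 → Set.Icc (0 : ℝ) 1) :
    (asymmetric a lam ha₀ ha₁ hlam).Policy where
  Mem := Unit
  mem_countable := inferInstance
  assign n _ s := (coin (x s)).map fun b => serve n (if b then zNew else zFailed)
  outstanding n _ s z h := by
    rw [← PMF.mem_support_iff, PMF.mem_support_map_iff] at h
    obtain ⟨b, -, h⟩ := h
    unfold serve at h
    split_ifs at h <;> simp_all <;> omega
  update _ _ _ := PMF.pure ()

theorem expect_staticPolicy_assign (x : Fin 2 → Set.Icc (0 : ℝ) 1) (n : (sys).State) (m : Unit)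
    (s : Fin 2) (g : Option (sys).Z → ℝ≥0∞) {r r' : ℝ} (hr : 0 ≤ r) (hr' : 0 ≤ r')
    (h : g (serve n zNew) = ENNReal.ofReal r) (h' : g (serve n zFailed) = ENNReal.ofReal r') :
    expect ((staticPolicy (ha₀ := ha₀) (ha₁ := ha₁) (hlam := hlam) x).assign n m s) g =
      ENNReal.ofReal (x s * r + (1 - x s) * r') := by
  have h0 : 0 ≤ (x s : ℝ) := (x s).2.1
  have h1 : 0 ≤ 1 - (x s : ℝ) := sub_nonneg.2 (x s).2.2
  change expect ((coin (x s)).map _) g = _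
  rw [expect_map, expect_fintype, Fintype.sum_bool,
    ENNReal.ofReal_add (mul_nonneg h0 hr) (mul_nonneg h1 hr'), ENNReal.ofReal_mul h0,
    ENNReal.ofReal_mul h1, ← h, ← h']
  simp [coin]

/-- Each queue has negative drift whenever it is nonempty. In i² + j² the drift of a queue is
weighted by its length, so an empty queue, whose drift may be positive, contributes only a bounded
term; a linear function would not have this property. -/
theorem staticPolicy_stabilizes (x : Fin 2 → Set.Icc (0 : ℝ) 1) (h₁ : lam < x 0 + x 1)
    (h₂ : x 0 * ((1 - a) / 2) + x 1 / 2 < a * (1 - x 0)) :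
    (staticPolicy (ha₀ := ha₀) (ha₁ := ha₁) (hlam := hlam) x).Stabilizes := by
  obtain ⟨e, he, he₁, he₂⟩ : ∃ e : ℝ, 0 < e ∧ e ≤ x 0 + x 1 - lam ∧
      e ≤ a * (1 - x 0) - (x 0 * ((1 - a) / 2) + x 1 / 2) :=
    ⟨min _ _, lt_min (sub_pos.2 h₁) (sub_pos.2 h₂), min_le_left _ _, min_le_right _ _⟩
  -- The drift is at most -2e(i + j) + λ + 5, hence at most -1 once i + j ≥ M.
  obtain ⟨M, hM⟩ := exists_nat_ge ((lam + 6) / (2 * e))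
  rw [div_le_iff₀ (by linarith)] at hM
  have hv : ∀ i j : ℕ, 0 ≤ (i : ℝ) ^ 2 + (j : ℝ) ^ 2 := fun i j => by positivity
  have : Finite (staticPolicy (ha₀ := ha₀) (ha₁ := ha₁) (hlam := hlam) x).Mem :=
    inferInstanceAs (Finite Unit)
  refine stabilizes_of_drift (v := fun i j => (i : ℝ) ^ 2 + (j : ℝ) ^ 2) (staticPolicy x)
    () hv 1 (lam + 6) one_pos (by linarith) M ?_
  rintro ⟨n, m⟩
  have x0 : 0 ≤ (x 0 : ℝ) := (x 0).2.1
  have x0' : (x 0 : ℝ) ≤ 1 := (x 0).2.2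
  have x1 : 0 ≤ (x 1 : ℝ) := (x 1).2.1
  have x1' : (x 1 : ℝ) ≤ 1 := (x 1).2.2
  have hψ : ∀ s z, 0 ≤ 1 - (sys).psi s z := fun s z => sub_nonneg.2 ((sys).psi_le_one s z)
  let v : ℕ → ℕ → ℝ := fun i j => (i : ℝ) ^ 2 + (j : ℝ) ^ 2
  let A : Fin 2 → ℝ := fun s => if n zNew = 0 then v (n zNew) (n zFailed) else
    (sys).psi s zNew * v (n zNew - 1) (n zFailed + 1) +
      (1 - (sys).psi s zNew) * v (n zNew - 1) (n zFailed)
  let B : Fin 2 → ℝ := fun s => if n zFailed = 0 then v (n zNew) (n zFailed) else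
    (sys).psi s zFailed * v (n zNew) (n zFailed) +
      (1 - (sys).psi s zFailed) * v (n zNew) (n zFailed - 1)
  have hA : ∀ s, 0 ≤ A s := fun s => by
    dsimp only [A]
    split_ifs
    · exact hv _ _
    · exact add_nonneg (mul_nonneg ((sys).psi_nonneg _ _) (hv _ _)) (mul_nonneg (hψ _ _) (hv _ _))
  have hB : ∀ s, 0 ≤ B s := fun s => by
    dsimp only [B]
    split_ifs
    · exact hv _ _
    · exact add_nonneg (mul_nonneg ((sys).psi_nonneg _ _) (hv _ _)) (mul_nonneg (hψ _ _) (hv _ _))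
  have hA' : ∀ s, attemptValue (ofCounts v) n s (serve n zNew) = ENNReal.ofReal (A s) := by
    intro s
    by_cases h : n zNew = 0
    · simp only [serve, A, if_pos h]; rfl
    · simp only [serve, A, if_neg h]; exact attemptValue_zNew hv n s
  have hB' : ∀ s, attemptValue (ofCounts v) n s (serve n zFailed) = ENNReal.ofReal (B s) := by
    intro s
    by_cases h : n zFailed = 0
    · simp only [serve, B, if_pos h]; rfl
    · simp only [serve, B, if_neg h]; exact attemptValue_zFailed hv (Nat.pos_of_ne_zero h) s
  refine ⟨x 0 * A 0 + (1 - x 0) * B 0, x 1 * A 1 + (1 - x 1) * B 1,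
    add_nonneg (mul_nonneg x0 (hA _)) (mul_nonneg (by linarith) (hB _)),
    add_nonneg (mul_nonneg x1 (hA _)) (mul_nonneg (by linarith) (hB _)),
    (expect_staticPolicy_assign x n m 0 _ (hA _) (hB _) (hA' _) (hB' _)).le,
    (expect_staticPolicy_assign x n m 1 _ (hA _) (hB _) (hA' _) (hB' _)).le, ?_⟩
  suffices hmain : lam * v (n zNew + 1) (n zFailed) + (x 0 * A 0 + (1 - x 0) * B 0) +
      (x 1 * A 1 + (1 - x 1) * B 1) ≤ (lam + 2) * v (n zNew) (n zFailed) -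
        2 * e * (n zNew + n zFailed) + (lam + 5) by
    dsimp only [v] at hmain ⊢
    split_ifs with hle
    · have : 0 ≤ 2 * e * ((n zNew : ℝ) + n zFailed) := by positivity
      linarith
    · have h3 : (M : ℝ) ≤ n zNew + n zFailed := by exact_mod_cast (not_le.1 hle).le
      have : M * (2 * e) ≤ 2 * e * ((n zNew : ℝ) + n zFailed) := by nlinarith
      linarith
  have hxa : 0 ≤ (x 0 : ℝ) * (1 - a) := mul_nonneg x0 (by linarith)
  have hxa' : 0 ≤ (x 0 : ℝ) * a := mul_nonneg x0 ha₀.le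
  dsimp only [A, B, v]
  simp only [psi_zero_zNew, psi_one_zNew, psi_zero_zFailed, psi_one_zFailed]
  rcases Nat.eq_zero_or_pos (n zNew) with hi | hi
  · rcases Nat.eq_zero_or_pos (n zFailed) with hj | hj
    · simp [hi, hj]
    · obtain ⟨l, hl⟩ := Nat.exists_eq_add_of_le' hj
      have hle : 0 ≤ ((l : ℝ) + 1) * (a * (1 - x 0) - e) :=
        mul_nonneg (by positivity) (by nlinarith)
      simp only [hi, hl, if_true, Nat.succ_ne_zero, if_false, Nat.add_sub_cancel]
      push_cast
      nlinarith
  · obtain ⟨k, hk⟩ := Nat.exists_eq_add_of_le' hi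
    have hke : 0 ≤ ((k : ℝ) + 1) * (x 0 + x 1 - lam - e) :=
        mul_nonneg (by positivity) (by linarith)
    rcases Nat.eq_zero_or_pos (n zFailed) with hj | hj
    · simp only [hj, hk, if_true, Nat.succ_ne_zero, if_false, Nat.add_sub_cancel]
      push_cast
      nlinarith
    · obtain ⟨l, hl⟩ := Nat.exists_eq_add_of_le' hj
      have hle : 0 ≤ ((l : ℝ) + 1) * (a * (1 - x 0) - (x 0 * ((1 - a) / 2) + x 1 / 2) - e) :=
        mul_nonneg (by positivity) (by linarith)
      simp only [hl, hk, Nat.succ_ne_zero, if_false, Nat.add_sub_cancel]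
      push_cast
      nlinarith

theorem isStabilizable_of_lt (h : lam < min (2 * a) (3 * a / (1 + a))) : (sys).IsStabilizable := by
  -- Primal optima. For a ≤ 1/2 the first expert serves only z'' and the second takes the share 2a
  -- of z'; for a ≥ 1/2 the second serves only z' and the first balances the flow of z''.
  obtain ⟨y₀, y₁, hy₀, hy₀', hy₁, hy₁', hsum, hflow⟩ : ∃ y₀ y₁ : ℝ, 0 ≤ y₀ ∧ y₀ ≤ 1 ∧ 0 ≤ y₁ ∧
      y₁ ≤ 1 ∧ lam < y₀ + y₁ ∧ y₀ * ((1 - a) / 2) + y₁ / 2 ≤ a * (1 - y₀) := by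
    rw [lt_min_iff] at h
    rcases le_total a (1 / 2) with ha | ha
    · exact ⟨0, 2 * a, le_rfl, zero_le_one, by linarith, by linarith, by linarith [h.1],
        by linarith⟩
    · have hp : 0 < 1 + a := by linarith
      refine ⟨(2 * a - 1) / (1 + a), 1, div_nonneg (by linarith) hp.le, ?_, zero_le_one, le_rfl,
        ?_, ?_⟩
      · rw [div_le_one hp]; linarith
      · refine h.2.trans_eq ?_
        field_simp
        ring
      · refine le_of_eq ?_
        field_simp
        ring
  -- Shrinking both shares by θ < 1 makes the flow inequality strict while keeping the total above
  -- λ.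
  obtain ⟨θ, hθ, hθ1⟩ := exists_between ((div_lt_one (hlam.trans hsum)).2 hsum)
  have hθ0 : 0 < θ := (div_pos hlam (hlam.trans hsum)).trans hθ
  rw [div_lt_iff₀ (hlam.trans hsum)] at hθ
  refine ⟨_, staticPolicy_stabilizes ![⟨θ * y₀, by positivity, by nlinarith⟩,
    ⟨θ * y₁, by positivity, by nlinarith⟩] ?_ ?_⟩
  · simp
    linarith
  · simp
    nlinarith

end Throughput

end TaskExpert

theorem proposition3 (a : ℝ) (ha₀ : 0 < a) (ha₁ : a < 1) :
    (∀ (lam : ℝ) (hlam : 0 < lam),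
      (TaskExpert.asymmetric a lam ha₀ ha₁ hlam).preemptiveGreedy.Stabilizes ↔
        lam < 4 * a / (2 + a)) ∧
    ∃ opt : ℝ,
      IsLUB {lam : ℝ | ∃ hlam : 0 < lam,
        (TaskExpert.asymmetric a lam ha₀ ha₁ hlam).IsStabilizable} opt ∧
      4 * a / (2 + a) < opt ∧
      (a = 1 / 2 → 4 * a / (2 + a) = 4 / 5 ∧ opt = (1 + 25 / 100) * (4 * a / (2 + a))) := by
  refine ⟨fun lam hlam => ⟨TaskExpert.lt_of_preemptiveGreedy_stabilizes,
    TaskExpert.preemptiveGreedy_stabilizes⟩, min (2 * a) (3 * a / (1 + a)), ⟨?_, ?_⟩, ?_, ?_⟩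
  · rintro lam ⟨hlam, h⟩
    exact TaskExpert.le_of_isStabilizable h
  · intro b hb
    have hopt : 0 < min (2 * a) (3 * a / (1 + a)) := lt_min (by positivity) (by positivity)
    by_contra! hlt
    -- The maximum with 0 ensures that the rate found above `b` is admissible, that is, positive.
    obtain ⟨lam, h₁, h₂⟩ := exists_between (max_lt hlt hopt)
    rw [max_lt_iff] at h₁
    exact (hb ⟨h₁.2, TaskExpert.isStabilizable_of_lt h₂⟩).not_gt h₁.1
  · refine lt_min ?_ ?_
    · rw [div_lt_iff₀ (by linarith)]
      nlinarith
    · rw [div_lt_div_iff₀ (by linarith) (by linarith)]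
      nlinarith
  · rintro rfl
    norm_num
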